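/- Let $\mathscr M$ be an infinite-dimensional separable real Hilbert space, $\mu=\mathcal N(0,\mathcal C)$ a centred Gaussian measure on $\mathscr M$ with covariance operator $\mathcal C$, and $\mathscr H_\mu\subset\mathscr M$ its Cameron–Martin space, i.e. $\{h\in\mathscr M:\|h\|_{\mathcal C^{-1}}<\infty\}$ with the inner product $\langle\cdot,\cdot\rangle_{\mathcal C^{-1}}$. Let $d\ge 1$, let $C_n\in\mathbb R^{d\times d}$ be symmetric positive definite, and let $\mathscr Y$ be $\mathbb R^{d}$ with the norm $\|v\|_{C_n^{-1}}=(v^{T}C_n^{-1}v)^{1/2}$. A function $F:\mathscr M\to\mathbb R^d$ is * *stochastically Gâteaux differentiable* if there is a map $D_{\mathscr H_\mu}F:\mathscr M\to \mathrm{HS}(\mathscr H_\mu,\mathscr Y)$ (Hilbert–Schmidt operators) such that for every $k\in\mathscr H_\mu$, for $\mu$-a.e. $m$, $$\lim_{t\to0}\big\|t^{-1}(F(m+tk)-F(m))-D_{\mathscr H_\mu}F(m)k\big\|_{C_n^{-1}}=0;$$ * *$\mu$-a.e. Gâteaux differentiable* if there is a map $DF:\mathscr M\to \mathrm{HS}(\mathscr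 M,\mathbb R^d)$ such that for every $h\in\mathscr M$, for $\mu$-a.e. $m$, $$\lim_{t\to0}\big\|t^{-1}(F(m+th)-F(m))-DF(m)h\big\|=0 .$$ Let $\mathcal G$ be a map from $\mathscr M$ to $\mathbb R^d$ that is defined $\mu$-a.e. and undetermined on $\mu$-null sets, i.e. an equivalence class of functions $\mathscr M\to\mathbb R^d$ modulo $\mu$-a.e. equality; the functions in the class are its versions. Such a class is called stochastically (respectively $\mu$-a.e.) Gâteaux differentiable if each of its versions satisfies the corresponding definition above with the almost sure limit $t\to0$ understood along sequences: for every direction and every sequence $t_n\to0$ with $t_n\ne0$ for all large $n$, the limit along $(t_n)$ is $0$ for $\mu$-a.e. $m$. Then: 1. No class $\mathcal G$ is $\mu$-a.e. Gâteaux differentiable. 2. If a function $F$ is stochastically Gâteaux differentiable, then so is its class. In particular stochastic Gâteaux differentiability of $\mathcal G$ does not imply $\mu$-a.e. Gâteaux differentiability of $\mathcal G$. 3. $\mathscr H_\mu\ne\mathscr M$, and for every $h\in\mathscr M\setminus\mathscr H_\mu$: for every $t\neq0$ the law of $X+th$, where $X\sim\mu$, and $\mu$ are mutually singular; and every function $F:\mathscr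 M\to\mathbb R^d$ has a version $F'=F$ $\mu$-a.e. (Borel measurable if $F$ is) such that every stochastic derivative of $F$ is a stochastic derivative of $F'$, while for $\mu$-a.e. $m$ the function $t\mapsto F'(m+th)$ is not differentiable at $t=0$; so $F'$ is not $\mu$-a.e. Gâteaux differentiable. -/

import Mathlib

open MeasureTheory ProbabilityTheory Filter Topology

noncomputable section

namespace StochGateaux

variable {M : Type*} [NormedAddCommGroup M] [InnerProductSpace ℝ M] [CompleteSpace M]
  [MeasurableSpace M] [BorelSpace M]

/-! ### The Cameron--Martin space of a centred measure with covariance operator `C` -/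

/-- `J : M → L²(μ)`, sending `l` to (the class of) the function `x ↦ ⟪l, x⟫`. -/
def dualToL2 (μ : Measure M) : M →L[ℝ] Lp ℝ 2 μ :=
  (StrongDual.toLp (𝕜 := ℝ) μ 2).comp
    (InnerProductSpace.toDual ℝ M).toContinuousLinearEquiv.toContinuousLinearMap

/-- The closure in `L²(μ)` of the functions `⟪l, ·⟫`, `l ∈ M`. -/
def dualClosure (μ : Measure M) : Submodule ℝ (Lp ℝ 2 μ) :=
  (LinearMap.range (dualToL2 μ).toLinearMap).topologicalClosure

/-- The Cameron--Martin space `H_μ` as an abstract Hilbert space: the closure in `L²(μ)` of the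
functions `⟪l, ·⟫`, `l ∈ M`, with the inner product of `L²(μ)`. It is realised inside `M` by the
injection `embed μ`. Under this identification `⟪l, ·⟫` corresponds to `C l`, so that
`⟪C l, C l'⟫_{H_μ} = ⟪C l, l'⟫ = ⟪C l, C⁻¹ (C l')⟫`; see `embed_dualToL2`,
`inner_dualToL2`, `embed_injective` and `mem_cameronMartin_iff` below. -/
abbrev CameronMartin (μ : Measure M) : Type _ := dualClosure μ

instance (μ : Measure M) : CompleteSpace (CameronMartin μ) :=
  (Submodule.isClosed_topologicalClosure _).completeSpace_coe

/-- The embedding `H_μ → M`, the adjoint of `J`, i.e. `f ↦ ∫ f(x) x μ(dx)`. -/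
def embed (μ : Measure M) : CameronMartin μ →L[ℝ] M :=
  (ContinuousLinearMap.adjoint (dualToL2 μ)).comp (dualClosure μ).subtypeL

/-- `H_μ` as a linear subspace of `M`. -/
def cameronMartin (μ : Measure M) : Submodule ℝ M :=
  LinearMap.range (embed μ).toLinearMap

theorem dualToL2_apply {μ : Measure M} (hμ : MemLp id 2 μ) (l : M) :
    (dualToL2 μ l : M → ℝ) =ᵐ[μ] fun x => inner ℝ l x := by
  have h : dualToL2 μ l = MemLp.toLp (InnerProductSpace.toDual ℝ M l)
      (hμ.continuousLinearMap_comp (InnerProductSpace.toDual ℝ M l)) :=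
    StrongDual.toLpₗ_apply hμ _
  rw [h]
  exact MemLp.coeFn_toLp (hμ.continuousLinearMap_comp (InnerProductSpace.toDual ℝ M l))

/-- The inner product of `H_μ` on the functions `⟪l, ·⟫` is given by the covariance operator. -/
theorem inner_dualToL2 {μ : Measure M} (hμ : MemLp id 2 μ) (l l' : M) :
    inner ℝ (dualToL2 μ l) (dualToL2 μ l') = inner ℝ (covarianceOperator μ l) l' := by
  rw [covarianceOperator_inner hμ, L2.inner_def]
  refine integral_congr_ae ?_
  filter_upwards [dualToL2_apply hμ l, dualToL2_apply hμ l'] with x hx hx'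
  rw [hx, hx']
  simp [mul_comm]

theorem dualToL2_mem (μ : Measure M) (l : M) : dualToL2 μ l ∈ dualClosure μ :=
  Submodule.le_topologicalClosure _ ⟨l, rfl⟩

theorem inner_embed (μ : Measure M) (l : M) (f : CameronMartin μ) :
    inner ℝ l (embed μ f) = inner ℝ (dualToL2 μ l) (f : Lp ℝ 2 μ) := by
  have h : embed μ f = ContinuousLinearMap.adjoint (dualToL2 μ) (f : Lp ℝ 2 μ) := rfl
  rw [h, ContinuousLinearMap.adjoint_inner_right]

/-- The function `⟪l, ·⟫` is sent to `C l`. -/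
theorem embed_dualToL2 {μ : Measure M} (hμ : MemLp id 2 μ) (l : M) :
    embed μ ⟨dualToL2 μ l, dualToL2_mem μ l⟩ = covarianceOperator μ l := by
  refine ext_inner_left ℝ fun l' => ?_
  rw [inner_embed, real_inner_comm, inner_dualToL2 hμ, real_inner_comm]

theorem embed_injective (μ : Measure M) : Function.Injective (embed μ) := by
  rw [injective_iff_map_eq_zero]
  intro f hf
  have h : (f : Lp ℝ 2 μ) ∈ (LinearMap.range (dualToL2 μ).toLinearMap)ᗮ := by
    rw [Submodule.mem_orthogonal]
    rintro _ ⟨l, rfl⟩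
    have := inner_embed μ l f
    rw [hf, inner_zero_right] at this
    exact this.symm
  rw [← Submodule.orthogonal_closure] at h
  have h1 : (f : Lp ℝ 2 μ) = 0 := by
    rw [← inner_self_eq_zero (𝕜 := ℝ)]
    exact Submodule.inner_right_of_mem_orthogonal f.2 h
  exact Subtype.ext h1

/-- `h ∈ H_μ` if and only if the norm
`‖h‖_{C⁻¹} = sup {|⟪l, h⟫| : ⟪C l, l⟫ ≤ 1}` is finite. -/
theorem mem_cameronMartin_iff {μ : Measure M} (hμ : MemLp id 2 μ) (h : M) :
    h ∈ cameronMartin μ ↔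
      ∃ K : ℝ, ∀ l : M, inner ℝ (covarianceOperator μ l) l ≤ 1 → |inner ℝ l h| ≤ K := by
  have hsq : ∀ l : M, ‖dualToL2 μ l‖ ^ 2 = inner ℝ (covarianceOperator μ l) l := fun l => by
    rw [← inner_dualToL2 hμ, real_inner_self_eq_norm_sq]
  constructor
  · rintro ⟨f, rfl⟩
    refine ⟨‖(f : Lp ℝ 2 μ)‖, fun l hl => ?_⟩
    rw [ContinuousLinearMap.coe_coe]
    have h2 : ‖dualToL2 μ l‖ ≤ 1 := by
      rw [← hsq] at hl
      exact (sq_le_one_iff₀ (norm_nonneg _)).1 hl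
    have h3 : |inner ℝ l (embed μ f)| ≤ ‖dualToL2 μ l‖ * ‖(f : Lp ℝ 2 μ)‖ := by
      rw [inner_embed]
      exact abs_real_inner_le_norm _ _
    exact h3.trans (mul_le_of_le_one_left (norm_nonneg _) h2)
  · rintro ⟨K, hK⟩
    have hK0 : 0 ≤ K := (abs_nonneg _).trans (hK 0 (by simp))
    have hscale : ∀ (r : ℝ) (l : M), ‖dualToL2 μ (r • l)‖ ≤ 1 → |r| * |inner ℝ l h| ≤ K := by
      intro r l hr
      have := hK (r • l) (by
        rw [← hsq]
        exact (sq_le_one_iff₀ (norm_nonneg _)).2 hr)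
      rwa [real_inner_smul_left, abs_mul] at this
    have hbound : ∀ l : M, |inner ℝ l h| ≤ K * ‖dualToL2 μ l‖ := by
      intro l
      rcases eq_or_ne (dualToL2 μ l) 0 with h0 | h0
      · rw [h0, norm_zero, mul_zero]
        by_contra! hlt
        have := hscale ((K + 1) / |inner ℝ l h|) l (by simp [h0])
        rw [abs_of_nonneg (by positivity), div_mul_cancel₀ _ hlt.ne'] at this
        linarith
      · have hn : 0 < ‖dualToL2 μ l‖ := norm_pos_iff.2 h0
        have := hscale (‖dualToL2 μ l‖⁻¹) l (by
          rw [map_smul, norm_smul, norm_inv, norm_norm, inv_mul_cancel₀ hn.ne'])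
        rw [abs_of_nonneg (by positivity), inv_mul_le_iff₀ hn] at this
        linarith
    obtain ⟨s, hs⟩ := (dualToL2 μ).toLinearMap.rangeRestrict.exists_rightInverse_of_surjective
      (LinearMap.range_rangeRestrict _)
    have hs' : ∀ y : LinearMap.range (dualToL2 μ).toLinearMap,
        dualToL2 μ (s y) = (y : Lp ℝ 2 μ) := fun y =>
      congrArg Subtype.val (LinearMap.congr_fun hs y)
    let φ : LinearMap.range (dualToL2 μ).toLinearMap →L[ℝ] ℝ :=
      LinearMap.mkContinuous ((innerSL ℝ h).toLinearMap.comp s) K (fun y => by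
        have := hbound (s y)
        rw [hs', real_inner_comm] at this
        exact this)
    obtain ⟨g, hg, -⟩ := exists_extension_norm_eq _ φ
    obtain ⟨f, hf⟩ : ∃ f : Lp ℝ 2 μ, ∀ y, inner ℝ f y = g y :=
      ⟨(InnerProductSpace.toDual ℝ (Lp ℝ 2 μ)).symm g,
        fun _ => InnerProductSpace.toDual_symm_apply⟩
    refine ⟨(dualClosure μ).orthogonalProjectionOnto f, ?_⟩
    refine ext_inner_left ℝ fun l => ?_
    have h1 := inner_embed μ l ((dualClosure μ).orthogonalProjectionOnto f)
    have h2 : inner ℝ (dualToL2 μ l) ((dualClosure μ).orthogonalProjectionOnto f : Lp ℝ 2 μ)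
        = inner ℝ (dualToL2 μ l) f :=
      (dualClosure μ).inner_orthogonalProjectionOnto_eq_of_mem_left ⟨dualToL2 μ l, dualToL2_mem μ l⟩ f
    have h3 : inner ℝ (dualToL2 μ l) f = g (dualToL2 μ l) := by
      rw [real_inner_comm, hf]
    have h4 : g (dualToL2 μ l) = inner ℝ h (s ⟨dualToL2 μ l, ⟨l, rfl⟩⟩) :=
      hg ⟨dualToL2 μ l, ⟨l, rfl⟩⟩
    have h5 : |inner ℝ (l - s ⟨dualToL2 μ l, ⟨l, rfl⟩⟩) h| ≤ 0 := by
      refine (hbound _).trans ?_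
      rw [map_sub, hs', sub_self, norm_zero, mul_zero]
    have h6 := abs_nonpos_iff.1 h5
    rw [inner_sub_left, sub_eq_zero] at h6
    exact (h1.trans (h2.trans (h3.trans h4))).trans ((real_inner_comm _ _).trans h6.symm)

/-! ### Hilbert--Schmidt operators and the noise-weighted norm -/

/-- `T` is Hilbert--Schmidt, where the codomain carries the norm `q`. -/
def IsHilbertSchmidt {E F : Type*} [NormedAddCommGroup E] [InnerProductSpace ℝ E]
    [NormedAddCommGroup F] [NormedSpace ℝ F] (q : F → ℝ) (T : E →L[ℝ] F) : Prop :=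
  ∀ s : Set E, Orthonormal ℝ ((↑) : s → E) → Summable fun e : s => q (T e) ^ 2

/-- The norm `‖v‖_{Cn⁻¹} = √(vᵀ Cn⁻¹ v)` on the observable space. -/
def noiseNorm {d : ℕ} (Cn : Matrix (Fin d) (Fin d) ℝ) (v : EuclideanSpace ℝ (Fin d)) : ℝ :=
  Real.sqrt (v.ofLp ⬝ᵥ (Cn⁻¹.mulVec v.ofLp))

/-! ### Differentiability of a function defined everywhere -/

variable {d : ℕ}

/-- `‖t⁻¹ (G(m + t k) - G(m)) - D(m) k‖_{Cn⁻¹}` for a direction `k ∈ H_μ`. -/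
def stochasticResidual (μ : Measure M) (Cn : Matrix (Fin d) (Fin d) ℝ)
    (G : M → EuclideanSpace ℝ (Fin d)) (D : M → CameronMartin μ →L[ℝ] EuclideanSpace ℝ (Fin d))
    (k : CameronMartin μ) (t : ℝ) (m : M) : ℝ :=
  noiseNorm Cn (t⁻¹ • (G (m + t • embed μ k) - G m) - D m k)

/-- `‖t⁻¹ (G(m + t h) - G(m)) - D(m) h‖` for a direction `h ∈ M`. -/
def gateauxResidual (G : M → EuclideanSpace ℝ (Fin d))
    (D : M → M →L[ℝ] EuclideanSpace ℝ (Fin d)) (h : M) (t : ℝ) (m : M) : ℝ :=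
  ‖t⁻¹ • (G (m + t • h) - G m) - D m h‖

/-- `D : M → HS(H_μ, Y)` is a stochastic derivative of the function `G`: for every `k ∈ H_μ`,
the residual tends to `0` as `t → 0`, for `μ`-a.e. `m`. -/
def HasStochasticDeriv (μ : Measure M) (Cn : Matrix (Fin d) (Fin d) ℝ)
    (G : M → EuclideanSpace ℝ (Fin d))
    (D : M → CameronMartin μ →L[ℝ] EuclideanSpace ℝ (Fin d)) : Prop :=
  (∀ m, IsHilbertSchmidt (noiseNorm Cn) (D m)) ∧
  ∀ k : CameronMartin μ, ∀ᵐ m ∂μ,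
    Tendsto (fun t : ℝ => stochasticResidual μ Cn G D k t m) (𝓝[≠] 0) (𝓝 0)

/-- `D : M → HS(M, ℝ^d)` is a `μ`-a.e. Gâteaux derivative of the function `G`. -/
def HasAEGateauxDeriv (μ : Measure M) (G : M → EuclideanSpace ℝ (Fin d))
    (D : M → M →L[ℝ] EuclideanSpace ℝ (Fin d)) : Prop :=
  (∀ m, IsHilbertSchmidt (fun v => ‖v‖) (D m)) ∧
  ∀ h : M, ∀ᵐ m ∂μ, Tendsto (fun t : ℝ => gateauxResidual G D h t m) (𝓝[≠] 0) (𝓝 0)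

/-! ### Differentiability of a map that is defined only up to `μ`-null sets

Such a map is an element of `Germ (ae μ) Y`, the functions `M → Y` modulo `μ`-a.e. equality; a
partial function whose domain has full measure determines one. A version is a function in the
class. For a version `F` and a fixed `t`, the residual at `t` is a random variable on `(M, μ)`.
Whenever its class does not depend on the version, neither does the a.s. convergence to `0` along
a fixed sequence `t n → 0`, whereas the limit over the uncountably many `t` at a fixed `m` can be
destroyed by changing `F` on a null set even in dimension one. Hence the a.s. limit `t → 0` of the
class is taken along arbitrary sequences. A property of the class is one that all versions have. -/

/-- As `HasStochasticDeriv`, with the a.s. limit taken along every sequence `t n → 0`. -/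
def HasStochasticDerivSeq (μ : Measure M) (Cn : Matrix (Fin d) (Fin d) ℝ)
    (F : M → EuclideanSpace ℝ (Fin d))
    (D : M → CameronMartin μ →L[ℝ] EuclideanSpace ℝ (Fin d)) : Prop :=
  (∀ m, IsHilbertSchmidt (noiseNorm Cn) (D m)) ∧
  ∀ k : CameronMartin μ, ∀ t : ℕ → ℝ, Tendsto t atTop (𝓝[≠] 0) →
    ∀ᵐ m ∂μ, Tendsto (fun n => stochasticResidual μ Cn F D k (t n) m) atTop (𝓝 0)

/-- As `HasAEGateauxDeriv`, with the a.s. limit taken along every sequence `t n → 0`. -/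
def HasAEGateauxDerivSeq (μ : Measure M) (F : M → EuclideanSpace ℝ (Fin d))
    (D : M → M →L[ℝ] EuclideanSpace ℝ (Fin d)) : Prop :=
  (∀ m, IsHilbertSchmidt (fun v => ‖v‖) (D m)) ∧
  ∀ h : M, ∀ t : ℕ → ℝ, Tendsto t atTop (𝓝[≠] 0) →
    ∀ᵐ m ∂μ, Tendsto (fun n => gateauxResidual F D h (t n) m) atTop (𝓝 0)

/-- Stochastic Gâteaux differentiability of a map defined up to `μ`-null sets. -/
def StochasticallyDifferentiable (μ : Measure M) (Cn : Matrix (Fin d) (Fin d) ℝ)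
    (G : Germ (ae μ) (EuclideanSpace ℝ (Fin d))) : Prop :=
  ∀ F : M → EuclideanSpace ℝ (Fin d), (F : Germ (ae μ) (EuclideanSpace ℝ (Fin d))) = G →
    ∃ D, HasStochasticDerivSeq μ Cn F D

/-- `μ`-a.e. Gâteaux differentiability of a map defined up to `μ`-null sets. -/
def AEGateauxDifferentiable (μ : Measure M)
    (G : Germ (ae μ) (EuclideanSpace ℝ (Fin d))) : Prop :=
  ∀ F : M → EuclideanSpace ℝ (Fin d), (F : Germ (ae μ) (EuclideanSpace ℝ (Fin d))) = G →
    ∃ D, HasAEGateauxDerivSeq μ F D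

end StochGateaux

end

/-! Everything rests on a Borel linear subspace `A` attached to each `h ∉ H_μ`. As `‖h‖_{C⁻¹} = ∞`,
there are vectors `u n` with `⟪u n, ·⟫ → 0` in `L²(μ)` but `|⟪u n, h⟫| > 1`. Along a subsequence the
convergence is a.e., and `A` is the set of `x` where it holds: `A` has full measure, contains `H_μ`
and misses `h` (`exists_subspace_of_notMem_cameronMartin`). For `m ∈ A` the line `m + t h` meets `A`
only at `t = 0`. So shifts along `h` are singular to `μ`, and a function may be redefined off `A` to
oscillate on all these lines (`exists_oscillating_extension`). Lines along `H_μ` stay in `A`, so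
stochastic derivatives survive. Such `h` exist in infinite dimension because `⟪e n, ·⟫ → 0` in
`L²(μ)` for orthonormal `e` (`exists_notMem_cameronMartin`). Passing from a function to its class
uses that shifts along `H_μ` preserve null sets (`quasiMeasurePreserving_add_embed`): `μ` splits as
a standard normal along a unit vector of `H_μ` and an independent remainder, and a shift moves only
the normal factor. -/

namespace StochGateaux

/-! ### Linear subspaces of full measure and oscillation transverse to them -/

section Basic

variable {M : Type*} [NormedAddCommGroup M] [InnerProductSpace ℝ M] {d : ℕ}

/-- The linear subspace of the `x` with `⟪u n, x⟫ → 0`. -/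
def innerNullSubspace (u : ℕ → M) : Submodule ℝ M where
  carrier := {x | Tendsto (fun n => inner ℝ (u n) x) atTop (𝓝 0)}
  add_mem' {x y} hx hy := by
    simpa [inner_add_right] using Tendsto.add hx hy
  zero_mem' := by simp
  smul_mem' c x hx := by
    simpa [inner_smul_right] using Tendsto.const_mul c hx

theorem mem_innerNullSubspace {u : ℕ → M} {x : M} :
    x ∈ innerNullSubspace u ↔ Tendsto (fun n => inner ℝ (u n) x) atTop (𝓝 0) := Iff.rfl

theorem tendsto_inv_add_one_nhdsNE :
    Tendsto (fun n : ℕ => ((n : ℝ) + 1)⁻¹) atTop (𝓝[≠] 0) := by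
  refine tendsto_nhdsWithin_iff.2 ⟨?_, Eventually.of_forall fun n => ?_⟩
  · simpa using tendsto_one_div_add_atTop_nhds_zero_nat (𝕜 := ℝ)
  · exact inv_ne_zero (Nat.cast_add_one_ne_zero n)

theorem LineDifferentiableAt.tendsto_inv_add_one {E F : Type*} [AddCommGroup E] [Module ℝ E]
    [NormedAddCommGroup F] [NormedSpace ℝ F] {f : E → F} {x v : E}
    (hf : LineDifferentiableAt ℝ f x v) :
    Tendsto (fun n : ℕ => f (x + ((n : ℝ) + 1)⁻¹ • v)) atTop (𝓝 (f x)) := by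
  have h := (DifferentiableAt.continuousAt hf).tendsto.comp
    (tendsto_nhds_of_tendsto_nhdsWithin tendsto_inv_add_one_nhdsNE)
  simpa [Function.comp_def] using h

theorem tendsto_of_tendsto_gateauxResidual {F : M → EuclideanSpace ℝ (Fin d)}
    {D : M → M →L[ℝ] EuclideanSpace ℝ (Fin d)} {h m : M} {t : ℕ → ℝ}
    (ht : Tendsto t atTop (𝓝[≠] 0))
    (hlim : Tendsto (fun n => gateauxResidual F D h (t n) m) atTop (𝓝 0)) :
    Tendsto (fun n => F (m + t n • h)) atTop (𝓝 (F m)) := by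
  have ht0 := tendsto_nhds_of_tendsto_nhdsWithin ht
  have h1 := tendsto_zero_iff_norm_tendsto_zero.2 hlim
  have h2 := ht0.smul (h1.add_const (D m h))
  rw [zero_smul] at h2
  have h3 := h2.add_const (F m)
  rw [zero_add] at h3
  refine h3.congr' ?_
  filter_upwards [ht.eventually self_mem_nhdsWithin] with n hn
  rw [sub_add_cancel, smul_inv_smul₀ hn, sub_add_cancel]

variable [MeasurableSpace M]

theorem HasAEGateauxDeriv.seq {μ : Measure M} {F : M → EuclideanSpace ℝ (Fin d)}
    {D : M → M →L[ℝ] EuclideanSpace ℝ (Fin d)} (hD : HasAEGateauxDeriv μ F D) :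
    HasAEGateauxDerivSeq μ F D := by
  refine ⟨hD.1, fun h t ht => ?_⟩
  filter_upwards [hD.2 h] with m hm using hm.comp ht

theorem not_hasAEGateauxDerivSeq {μ : Measure M} [NeZero μ] {F : M → EuclideanSpace ℝ (Fin d)}
    {h : M} (hF : ∀ᵐ m ∂μ, ∀ y,
      ¬ Tendsto (fun n : ℕ => F (m + ((n : ℝ) + 1)⁻¹ • h)) atTop (𝓝 y)) :
    ¬ ∃ D, HasAEGateauxDerivSeq μ F D := by
  rintro ⟨D, hD⟩
  obtain ⟨m, hm, hlim⟩ := (hF.and (hD.2 h _ tendsto_inv_add_one_nhdsNE)).exists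
  exact hm _ (tendsto_of_tendsto_gateauxResidual tendsto_inv_add_one_nhdsNE hlim)

variable [BorelSpace M]

/-- The shift by `h` carries `A` into its complement. -/
theorem mutuallySingular_map_add_of_subspace {μ : Measure M} {A : Submodule ℝ M}
    (hA : MeasurableSet (A : Set M)) (hAμ : ∀ᵐ m ∂μ, m ∈ A) {h : M} (hh : h ∉ A) :
    (μ.map fun m => m + h) ⟂ₘ μ := by
  refine ⟨A, hA, ?_, hAμ⟩
  rw [Measure.map_apply (by fun_prop) hA]
  refine measure_mono_null (fun m hm => ?_) hAμ
  exact fun hmA => hh ((A.add_mem_iff_right hmA).1 hm)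

/-- Redefining a function off a linear subspace `A` so that it oscillates on lines in a
direction `h ∉ A`. -/
theorem exists_oscillating_extension {E : Type*} [NormedAddCommGroup E] [MeasurableSpace E]
    [Nontrivial E] {A : Submodule ℝ M} (hA : MeasurableSet (A : Set M)) {h : M} (hh : h ∉ A)
    (F : M → E) :
    ∃ F' : M → E, (∀ m ∈ A, F' m = F m) ∧ (Measurable F → Measurable F') ∧
      ∀ m ∈ A, ∀ y, ¬ Tendsto (fun n : ℕ => F' (m + ((n : ℝ) + 1)⁻¹ • h)) atTop (𝓝 y) := by
  classical
  obtain ⟨e, he⟩ := exists_ne (0 : E)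
  have hAsmul : ∀ m ∈ A, ∀ s : ℝ, m + s • h ∈ A ↔ s = 0 := fun m hm s => by
    rw [A.add_mem_iff_right hm]
    refine ⟨fun hs => ?_, fun hs => by simp [hs]⟩
    by_contra hs0
    exact hh ((A.smul_mem_iff hs0).1 hs)
  -- `B` is the union of the cosets `A + h/(2n+1)`. Distinct multiples of `h` lie in distinct
  -- cosets, so `m + h/(n+1)` is in `B` exactly for even `n`, and `F'` alternates between `e` and
  -- `0` there.
  set B : Set M := ⋃ n : ℕ, (fun x => x + (-(((2 * n : ℕ) : ℝ) + 1)⁻¹) • h) ⁻¹' (A : Set M) with hB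
  have hBm : MeasurableSet B := MeasurableSet.iUnion fun n =>
    hA.preimage (by fun_prop)
  have hBmem : ∀ m ∈ A, ∀ n : ℕ, m + ((n : ℝ) + 1)⁻¹ • h ∈ B ↔ Even n := fun m hm n => by
    simp only [hB, Set.mem_iUnion, Set.mem_preimage, SetLike.mem_coe, add_assoc, ← add_smul]
    simp only [hAsmul m hm, add_neg_eq_zero, inv_inj, add_left_inj, Nat.cast_inj]
    rw [even_iff_exists_two_mul]
  refine ⟨fun x => if x ∈ A then F x else if x ∈ B then e else 0, fun m hm => if_pos hm,
    fun hF => Measurable.ite hA hF (Measurable.ite hBm measurable_const measurable_const),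
    fun m hm y hy => ?_⟩
  have hval : ∀ n : ℕ, (if m + ((n : ℝ) + 1)⁻¹ • h ∈ A then F (m + ((n : ℝ) + 1)⁻¹ • h)
      else if m + ((n : ℝ) + 1)⁻¹ • h ∈ B then e else 0) = if Even n then e else 0 := fun n => by
    have h0 : ¬ ((n : ℝ) + 1)⁻¹ = 0 := by positivity
    simp only [hAsmul m hm, hBmem m hm, h0, if_false]
  simp only [hval] at hy
  have h1 : Tendsto (fun _ : ℕ => e) atTop (𝓝 y) := by
    refine (hy.comp (tendsto_id.const_mul_atTop' (two_pos : (0 : ℕ) < 2))).congr fun n => ?_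
    simp
  have h2 : Tendsto (fun _ : ℕ => (0 : E)) atTop (𝓝 y) := by
    refine (hy.comp ((tendsto_add_atTop_nat 1).comp
      (tendsto_id.const_mul_atTop' (two_pos : (0 : ℕ) < 2)))).congr fun n => ?_
    simp
  exact he ((tendsto_nhds_unique tendsto_const_nhds h1).trans
    (tendsto_nhds_unique h2 tendsto_const_nhds))

end Basic

/-! ### Directions outside the Cameron–Martin space -/

section SecondMoment

variable {M : Type*} [NormedAddCommGroup M] [InnerProductSpace ℝ M] [CompleteSpace M]
  [MeasurableSpace M] [BorelSpace M]

theorem norm_dualToL2_sq {μ : Measure M} (hμ : MemLp id 2 μ) (l : M) :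
    ‖dualToL2 μ l‖ ^ 2 = ∫ x, inner ℝ l x ^ 2 ∂μ := by
  rw [← real_inner_self_eq_norm_sq, inner_dualToL2 hμ, covarianceOperator_inner hμ]
  simp_rw [sq]

theorem exists_orthonormal_nat {E : Type*} [NormedAddCommGroup E] [InnerProductSpace ℝ E]
    [CompleteSpace E] (hE : ¬ FiniteDimensional ℝ E) : ∃ e : ℕ → E, Orthonormal ℝ e := by
  obtain ⟨w, b, hb⟩ := exists_hilbertBasis ℝ E
  have hw : Infinite w := by
    by_contra hfin
    rw [not_infinite_iff_finite] at hfin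
    have := Fintype.ofFinite w
    exact hE b.toOrthonormalBasis.toBasis.finiteDimensional_of_finite
  exact ⟨fun n => b (Infinite.natEmbedding w n),
    b.orthonormal.comp _ (Infinite.natEmbedding w).injective⟩

/-- Bessel's inequality gives `⟪e n, x⟫ → 0` pointwise, and the squares are dominated by `‖x‖²`. -/
theorem tendsto_dualToL2_of_orthonormal [SecondCountableTopology M] {μ : Measure M}
    (hμ : MemLp id 2 μ)
    {e : ℕ → M} (he : Orthonormal ℝ e) : Tendsto (fun n => dualToL2 μ (e n)) atTop (𝓝 0) := by
  have h : Tendsto (fun n => ∫ x, inner ℝ (e n) x ^ 2 ∂μ) atTop (𝓝 (∫ _ : M, (0 : ℝ) ∂μ)) := by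
    refine tendsto_integral_of_dominated_convergence (fun x => ‖x‖ ^ 2)
      (fun n => by fun_prop) (hμ.integrable_norm_pow two_ne_zero) (fun n => ?_) ?_
    · refine Eventually.of_forall fun x => ?_
      rw [norm_pow]
      gcongr
      simpa [he.1 n] using norm_inner_le_norm (𝕜 := ℝ) (e n) x
    · refine Eventually.of_forall fun x => ?_
      simpa using (he.inner_products_summable (x := x)).tendsto_atTop_zero
  simp_rw [← norm_dualToL2_sq hμ, integral_zero] at h
  rw [tendsto_zero_iff_norm_tendsto_zero]
  simpa [Real.sqrt_sq] using h.sqrt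

/-- Were `embed μ` onto, the open mapping theorem would give `e n = embed μ f` with `‖f‖ ≤ K`,
whence `1 = ⟪J (e n), f⟫ ≤ K ‖J (e n)‖ → 0`. -/
theorem exists_notMem_cameronMartin [SecondCountableTopology M] (hM : ¬ FiniteDimensional ℝ M)
    {μ : Measure M} (hμ : MemLp id 2 μ) : ∃ h : M, h ∉ cameronMartin μ := by
  by_contra! hall
  obtain ⟨K, hK, hpre⟩ := (embed μ).exists_preimage_norm_le fun h => hall h
  obtain ⟨e, he⟩ := exists_orthonormal_nat hM
  have hlim := ((tendsto_dualToL2_of_orthonormal hμ he).norm.mul_const K)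
  rw [norm_zero, zero_mul] at hlim
  refine absurd (ge_of_tendsto' hlim fun n => ?_) (not_le.2 one_pos)
  obtain ⟨f, hf, hfK⟩ := hpre (e n)
  rw [he.1 n, mul_one] at hfK
  calc (1 : ℝ) = inner ℝ (e n) (embed μ f) := by rw [hf, real_inner_self_eq_norm_sq, he.1 n]; simp
    _ = inner ℝ (dualToL2 μ (e n)) (f : Lp ℝ 2 μ) := inner_embed μ _ f
    _ ≤ ‖dualToL2 μ (e n)‖ * ‖(f : Lp ℝ 2 μ)‖ := real_inner_le_norm _ _
    _ ≤ ‖dualToL2 μ (e n)‖ * K := by gcongr; exact hfK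

/-- A direction outside the Cameron--Martin space is separated from it by a Borel linear subspace
of full measure. -/
theorem exists_subspace_of_notMem_cameronMartin [SecondCountableTopology M] {μ : Measure M}
    (hμ : MemLp id 2 μ) {h : M} (hh : h ∉ cameronMartin μ) :
    ∃ A : Submodule ℝ M, MeasurableSet (A : Set M) ∧ (∀ᵐ m ∂μ, m ∈ A) ∧
      cameronMartin μ ≤ A ∧ h ∉ A := by
  rw [mem_cameronMartin_iff hμ] at hh
  push Not at hh
  choose l hl1 hl2 using fun n : ℕ => hh (n + 1)
  -- Dividing by `n + 1` makes the `L²` norms vanish while `|⟪u n, h⟫|` stays above `1`.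
  set u : ℕ → M := fun n => ((n : ℝ) + 1)⁻¹ • l n with hu
  have hl3 : ∀ n, ‖dualToL2 μ (l n)‖ ≤ 1 := fun n => by
    rw [← sq_le_one_iff₀ (norm_nonneg _), ← real_inner_self_eq_norm_sq, inner_dualToL2 hμ]
    exact hl1 n
  have hu0 : Tendsto (fun n => dualToL2 μ (u n)) atTop (𝓝 0) := by
    refine squeeze_zero_norm (a := fun n : ℕ => ((n : ℝ) + 1)⁻¹) (fun n => ?_)
      (by simpa using tendsto_one_div_add_atTop_nhds_zero_nat (𝕜 := ℝ))
    rw [hu, map_smul, norm_smul, Real.norm_of_nonneg (by positivity)]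
    exact mul_le_of_le_one_right (by positivity) (hl3 n)
  have hu1 : ∀ n, 1 < |inner ℝ (u n) h| := fun n => by
    rw [hu, real_inner_smul_left, abs_mul, abs_of_pos (by positivity),
      lt_inv_mul_iff₀ (by positivity), mul_one]
    exact hl2 n
  obtain ⟨φ, hφ, hae⟩ := (tendstoInMeasure_of_tendsto_Lp hu0).exists_seq_tendsto_ae
  refine ⟨innerNullSubspace (u ∘ φ), ?_, ?_, ?_, ?_⟩
  · exact measurableSet_tendsto (𝓝 (0 : ℝ)) fun n => by fun_prop
  · filter_upwards [hae, ae_all_iff.2 fun n => dualToL2_apply hμ (u n), Lp.coeFn_zero ℝ 2 μ]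
      with x hx hx' hx0
    rw [hx0] at hx
    simp only [hx'] at hx
    exact hx
  · rintro _ ⟨f, rfl⟩
    rw [mem_innerNullSubspace, ContinuousLinearMap.coe_coe]
    simp_rw [inner_embed]
    simpa using ((hu0.comp hφ.tendsto_atTop).inner tendsto_const_nhds : Tendsto
      (fun n => inner ℝ (dualToL2 μ (u (φ n))) (f : Lp ℝ 2 μ)) atTop _)
  · intro hmem
    have h1 := (mem_innerNullSubspace.1 hmem).abs
    rw [abs_zero] at h1
    exact absurd (ge_of_tendsto' h1 fun n => (hu1 (φ n)).le) (not_le.2 one_pos)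

end SecondMoment

/-! ### Quasi-invariance under Cameron–Martin shifts -/

section Gaussian

variable {M : Type*} [NormedAddCommGroup M] [InnerProductSpace ℝ M] [CompleteSpace M]
  [SecondCountableTopology M] [MeasurableSpace M] [BorelSpace M]
  {μ : Measure M} [IsGaussian μ]

theorem integral_cexp_dualToL2 (hμ : ∫ x, x ∂μ = 0) (l : M) :
    ∫ x, Complex.exp (dualToL2 μ l x * Complex.I) ∂μ =
      Complex.exp (-(‖dualToL2 μ l‖ ^ 2 : ℝ) / 2) := by
  have h2 : MemLp id 2 μ := IsGaussian.memLp_two_id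
  have hmean : ∫ x, inner ℝ l x ∂μ = 0 := by
    have := integral_inner (𝕜 := ℝ) (h2.integrable one_le_two) l
    simpa [hμ] using this
  have h := IsGaussian.charFun_eq (μ := μ) l
  rw [integral_complex_ofReal, hmean, variance_of_integral_eq_zero (by fun_prop) hmean] at h
  simp only [norm_dualToL2_sq h2]
  rw [charFun_apply] at h
  convert h using 1
  · refine integral_congr_ae ?_
    filter_upwards [dualToL2_apply h2 l] with x hx
    rw [hx, real_inner_comm]
  · simp [neg_div]

/-- The elements of the `L²`-closure of the functions `⟪l, ·⟫` are centred Gaussian. -/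
theorem integral_cexp_of_mem_dualClosure (hμ : ∫ x, x ∂μ = 0) {g : Lp ℝ 2 μ}
    (hg : g ∈ dualClosure μ) :
    ∫ x, Complex.exp (g x * Complex.I) ∂μ = Complex.exp (-(‖g‖ ^ 2 : ℝ) / 2) := by
  obtain ⟨v, hv, hvg⟩ := mem_closure_iff_seq_limit.1 hg
  choose l hl using hv
  obtain ⟨φ, hφ, hae⟩ := (tendstoInMeasure_of_tendsto_Lp hvg).exists_seq_tendsto_ae
  have h1 : Tendsto (fun n => ∫ x, Complex.exp (v (φ n) x * Complex.I) ∂μ) atTop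
      (𝓝 (∫ x, Complex.exp (g x * Complex.I) ∂μ)) := by
    refine tendsto_integral_of_dominated_convergence (fun _ => 1) (fun n => ?_)
      (integrable_const _) (fun n => ?_) ?_
    · have := (Lp.stronglyMeasurable (v (φ n))).measurable
      fun_prop
    · exact Eventually.of_forall fun x => (Complex.norm_exp_ofReal_mul_I _).le
    · filter_upwards [hae] with x hx
      exact (Complex.continuous_exp.tendsto _).comp
        (((Complex.continuous_ofReal.tendsto _).comp hx).mul_const _)
  have h2 : Tendsto (fun n => ∫ x, Complex.exp (v (φ n) x * Complex.I) ∂μ) atTop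
      (𝓝 (Complex.exp (-(‖g‖ ^ 2 : ℝ) / 2))) := by
    have h3 : ∀ n, ∫ x, Complex.exp (v (φ n) x * Complex.I) ∂μ =
        Complex.exp (-(‖v (φ n)‖ ^ 2 : ℝ) / 2) := fun n => by
      rw [← hl (φ n)]
      exact integral_cexp_dualToL2 hμ _
    simp_rw [h3]
    have hc : Continuous fun w : Lp ℝ 2 μ => Complex.exp (-(‖w‖ ^ 2 : ℝ) / 2) := by fun_prop
    exact (hc.tendsto g).comp (hvg.comp hφ.tendsto_atTop)
  exact tendsto_nhds_unique h1 h2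

theorem map_eq_gaussianReal_of_norm_eq_one (hμ : ∫ x, x ∂μ = 0) {f : CameronMartin μ}
    (hf : ‖f‖ = 1) : μ.map (f : Lp ℝ 2 μ) = gaussianReal 0 1 := by
  have hfm : Measurable (f : Lp ℝ 2 μ) := (Lp.stronglyMeasurable (f : Lp ℝ 2 μ)).measurable
  have := Measure.isProbabilityMeasure_map hfm.aemeasurable (μ := μ)
  refine Measure.ext_of_charFun (funext fun s => ?_)
  rw [charFun_gaussianReal, charFun_apply_real, integral_map hfm.aemeasurable (by fun_prop)]
  have h := integral_cexp_of_mem_dualClosure hμ ((dualClosure μ).smul_mem s f.2)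
  rw [norm_smul, ← Submodule.coe_norm, hf] at h
  convert h using 1
  · refine integral_congr_ae ?_
    filter_upwards [Lp.coeFn_smul s (f : Lp ℝ 2 μ)] with x hx
    rw [hx]
    simp
  · simp [neg_div]

/-- The component of `x` in the direction `embed μ f` is independent of the remainder. -/
theorem indepFun_sub_smul_embed (hμ : ∫ x, x ∂μ = 0) {f : CameronMartin μ} (hf : ‖f‖ = 1) :
    IndepFun (fun x => x - (f : Lp ℝ 2 μ) x • embed μ f) (f : Lp ℝ 2 μ) μ := by
  have h2 : MemLp id 2 μ := IsGaussian.memLp_two_id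
  have hfm : Measurable (f : Lp ℝ 2 μ) := (Lp.stronglyMeasurable (f : Lp ℝ 2 μ)).measurable
  have hff : inner ℝ (f : Lp ℝ 2 μ) (f : Lp ℝ 2 μ) = (1 : ℝ) := by
    rw [real_inner_self_eq_norm_sq, ← Submodule.coe_norm, hf, one_pow]
  rw [indepFun_iff_charFun_prod (by fun_prop) (by fun_prop)]
  intro t
  obtain ⟨l, s⟩ := t
  -- `w` represents `⟪l, ·⟫` of the remainder and is orthogonal to `f` because `⟪l, embed μ f⟫ = ⟪J
  -- l, f⟫`. By Pythagoras the Gaussian characteristic function of `w + s • f` factors.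
  set w : Lp ℝ 2 μ := dualToL2 μ l - (inner ℝ l (embed μ f) : ℝ) • (f : Lp ℝ 2 μ) with hw
  have hwmem : w ∈ dualClosure μ :=
    (dualClosure μ).sub_mem (dualToL2_mem μ l) ((dualClosure μ).smul_mem _ f.2)
  have hwx : ∀ᵐ x ∂μ, w x = inner ℝ (x - (f : Lp ℝ 2 μ) x • embed μ f) l := by
    filter_upwards [Lp.coeFn_sub (dualToL2 μ l) ((inner ℝ l (embed μ f) : ℝ) • (f : Lp ℝ 2 μ)),
      Lp.coeFn_smul (inner ℝ l (embed μ f) : ℝ) (f : Lp ℝ 2 μ), dualToL2_apply h2 l]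
      with x h1 h3 h4
    rw [hw, h1, Pi.sub_apply, h3, Pi.smul_apply, h4, inner_sub_left, real_inner_smul_left,
      real_inner_comm l x, real_inner_comm l (embed μ f), smul_eq_mul, mul_comm]
  have hsx : ∀ᵐ x ∂μ, (s • (f : Lp ℝ 2 μ) : Lp ℝ 2 μ) x = s * (f : Lp ℝ 2 μ) x := by
    filter_upwards [Lp.coeFn_smul s (f : Lp ℝ 2 μ)] with x hx
    rw [hx]
    simp
  have hwf : inner ℝ w (f : Lp ℝ 2 μ) = (0 : ℝ) := by
    rw [hw, inner_sub_left, real_inner_smul_left, hff, inner_embed, mul_one, sub_self]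
  have hnorm : ‖w + s • (f : Lp ℝ 2 μ)‖ ^ 2 = ‖w‖ ^ 2 + ‖s • (f : Lp ℝ 2 μ)‖ ^ 2 := by
    rw [norm_add_sq_real, real_inner_smul_right, hwf]
    ring
  have h := integral_cexp_of_mem_dualClosure hμ
    ((dualClosure μ).add_mem hwmem ((dualClosure μ).smul_mem s f.2))
  have hA := integral_cexp_of_mem_dualClosure hμ hwmem
  have hB := integral_cexp_of_mem_dualClosure hμ ((dualClosure μ).smul_mem s f.2)
  simp only [charFun_apply]
  rw [integral_map (by fun_prop) (by fun_prop), integral_map (by fun_prop) (by fun_prop),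
    integral_map (by fun_prop) (by fun_prop)]
  have e1 : ∫ x, Complex.exp ((inner ℝ (x - (f : Lp ℝ 2 μ) x • embed μ f) l : ℝ) * Complex.I) ∂μ
      = Complex.exp (-(‖w‖ ^ 2 : ℝ) / 2) := by
    rw [← hA]
    refine integral_congr_ae ?_
    filter_upwards [hwx] with x hx
    rw [hx]
  have e2 : ∫ x, Complex.exp ((inner ℝ ((f : Lp ℝ 2 μ) x) s : ℝ) * Complex.I) ∂μ
      = Complex.exp (-(‖s • (f : Lp ℝ 2 μ)‖ ^ 2 : ℝ) / 2) := by
    rw [← hB]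
    refine integral_congr_ae ?_
    filter_upwards [hsx] with x hx
    rw [hx]
    simp
  refine Eq.trans ?_ (congrArg₂ (· * ·) e1 e2).symm
  rw [← Complex.exp_add]
  refine Eq.trans ?_ (h.trans ?_)
  · refine integral_congr_ae ?_
    filter_upwards [hwx, hsx, Lp.coeFn_add w (s • (f : Lp ℝ 2 μ))] with x h1 h3 h4
    rw [h4, Pi.add_apply, h1, h3]
    simp [WithLp.prod_inner_apply]
  · rw [hnorm]
    congr 1
    push_cast
    ring

/-- In the coordinates (remainder, `f`) the measure is `ν ⊗ N(0,1)`; the shift turns it into `ν ⊗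
N(t,1)`, and `N(t,1) ≪ N(0,1)`. -/
theorem map_add_smul_embed_absolutelyContinuous (hμ : ∫ x, x ∂μ = 0) {f : CameronMartin μ}
    (hf : ‖f‖ = 1) (t : ℝ) : (μ.map fun m => m + t • embed μ f) ≪ μ := by
  have hfm : Measurable (f : Lp ℝ 2 μ) := (Lp.stronglyMeasurable (f : Lp ℝ 2 μ)).measurable
  set Φ : M → M × ℝ := fun x => (x - (f : Lp ℝ 2 μ) x • embed μ f, (f : Lp ℝ 2 μ) x) with hΦ
  set Ψ : M × ℝ → M := fun p => p.1 + p.2 • embed μ f with hΨ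
  set ν := μ.map fun x => x - (f : Lp ℝ 2 μ) x • embed μ f with hν
  have hΦm : Measurable Φ := by fun_prop
  have hΨm : Measurable Ψ := by fun_prop
  have hprod : μ.map Φ = ν.prod (gaussianReal 0 1) := by
    rw [← map_eq_gaussianReal_of_norm_eq_one hμ hf]
    exact (indepFun_iff_map_prod_eq_prod_map_map (by fun_prop) (by fun_prop)).1
      (indepFun_sub_smul_embed hμ hf)
  have : IsProbabilityMeasure ν := Measure.isProbabilityMeasure_map (by fun_prop)
  have hΨΦ : (ν.prod (gaussianReal 0 1)).map Ψ = μ := by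
    rw [← hprod, Measure.map_map hΨm hΦm]
    convert Measure.map_id (μ := μ)
    ext x
    simp [hΨ, hΦ]
  have hshift : (μ.map fun m => m + t • embed μ f)
      = (ν.prod (gaussianReal t 1)).map Ψ := by
    have : ν.prod (gaussianReal t 1) = (μ.map Φ).map (Prod.map id (· + t)) := by
      rw [hprod, ← Measure.map_prod_map _ _ measurable_id (by fun_prop), Measure.map_id,
        gaussianReal_map_add_const, zero_add]
    rw [this, Measure.map_map (by fun_prop) hΦm, Measure.map_map hΨm (by fun_prop)]
    congr 1
    ext x
    simp only [hΨ, hΦ, Function.comp_apply, Prod.map_apply, id_eq, add_smul]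
    abel
  rw [hshift]
  refine (Measure.AbsolutelyContinuous.map (Measure.AbsolutelyContinuous.prod .rfl ?_) hΨm).trans
    hΨΦ.absolutelyContinuous
  exact (gaussianReal_absolutelyContinuous t one_ne_zero).trans
    (gaussianReal_absolutelyContinuous' 0 one_ne_zero)

/-- Translations by elements of the Cameron--Martin space preserve null sets. -/
theorem quasiMeasurePreserving_add_embed (hμ : ∫ x, x ∂μ = 0) (k : CameronMartin μ) :
    Measure.QuasiMeasurePreserving (fun m => m + embed μ k) μ μ := by
  refine ⟨by fun_prop, ?_⟩
  rcases eq_or_ne k 0 with rfl | hk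
  · simp only [map_zero, add_zero]
    exact Measure.map_id.absolutelyContinuous
  · have hn : ‖k‖ ≠ 0 := norm_ne_zero_iff.2 hk
    have h := map_add_smul_embed_absolutelyContinuous hμ (f := ‖k‖⁻¹ • k)
      (by rw [norm_smul, norm_inv, norm_norm, inv_mul_cancel₀ hn]) ‖k‖
    rwa [map_smul, smul_smul, mul_inv_cancel₀ hn, one_smul] at h

end Gaussian

/-! ### Stability of stochastic derivatives under change of version -/

section Differentiability

variable {M : Type*} [NormedAddCommGroup M] [InnerProductSpace ℝ M] [CompleteSpace M]
  [MeasurableSpace M] [BorelSpace M] {d : ℕ}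

/-- Each shift `t n • k` costs one null set, and a sequence costs only countably many; over all `t`
at once this argument would fail. -/
theorem HasStochasticDeriv.seq_of_ae_eq [SecondCountableTopology M] {μ : Measure M} [IsGaussian μ]
    (hμ : ∫ x, x ∂μ = 0) {Cn : Matrix (Fin d) (Fin d) ℝ} {F F' : M → EuclideanSpace ℝ (Fin d)}
    {D : M → CameronMartin μ →L[ℝ] EuclideanSpace ℝ (Fin d)} (hD : HasStochasticDeriv μ Cn F D)
    (hF : F' =ᵐ[μ] F) : HasStochasticDerivSeq μ Cn F' D := by
  refine ⟨hD.1, fun k t ht => ?_⟩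
  have hshift : ∀ n, ∀ᵐ m ∂μ, F' (m + t n • embed μ k) = F (m + t n • embed μ k) := fun n => by
    rw [← map_smul]
    exact (quasiMeasurePreserving_add_embed hμ (t n • k)).ae hF
  filter_upwards [hF, ae_all_iff.2 hshift, hD.2 k] with m hm hmt hlim
  simpa only [Function.comp_def, stochasticResidual, hm, hmt] using hlim.comp ht

/-- Here the full limit `t → 0` survives: for `m ∈ A` the whole line `m + t k` lies in `A`, so no
null set depends on `t`. -/
theorem HasStochasticDeriv.of_eqOn_subspace {μ : Measure M}
    {Cn : Matrix (Fin d) (Fin d) ℝ} {F F' : M → EuclideanSpace ℝ (Fin d)}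
    {D : M → CameronMartin μ →L[ℝ] EuclideanSpace ℝ (Fin d)} (hD : HasStochasticDeriv μ Cn F D)
    {A : Submodule ℝ M} (hAμ : ∀ᵐ m ∂μ, m ∈ A) (hA : cameronMartin μ ≤ A)
    (hF : ∀ m ∈ A, F' m = F m) : HasStochasticDeriv μ Cn F' D := by
  refine ⟨hD.1, fun k => ?_⟩
  filter_upwards [hAμ, hD.2 k] with m hm hlim
  have h : ∀ t : ℝ, F' (m + t • embed μ k) = F (m + t • embed μ k) := fun t =>
    hF _ (A.add_mem hm (A.smul_mem t (hA ⟨k, rfl⟩)))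
  simpa only [stochasticResidual, hF m hm, h] using hlim

theorem hasStochasticDeriv_zero (μ : Measure M) (Cn : Matrix (Fin d) (Fin d) ℝ) :
    HasStochasticDeriv μ Cn (0 : M → EuclideanSpace ℝ (Fin d)) 0 := by
  have h0 : noiseNorm Cn 0 = 0 := by simp [noiseNorm]
  refine ⟨fun m s _ => ?_, fun k => Eventually.of_forall fun m => ?_⟩
  · simp [h0]
  · simp [stochasticResidual, h0]

end Differentiability

end StochGateaux

/-! ### The main theorem -/

open StochGateaux in
theorem mainTheorem5 {M : Type*} [NormedAddCommGroup M] [InnerProductSpace ℝ M]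
    [CompleteSpace M] [TopologicalSpace.SeparableSpace M] [MeasurableSpace M] [BorelSpace M]
    (hM : ¬ FiniteDimensional ℝ M)
    (μ : Measure M) [IsGaussian μ] (hμ : ∫ x, x ∂μ = 0)
    {d : ℕ} (hd : 0 < d) (Cn : Matrix (Fin d) (Fin d) ℝ) (hCn : Cn.PosDef) :
    -- a map that is defined only up to null sets is never a.e. Gâteaux differentiable
    (∀ G : Germ (ae μ) (EuclideanSpace ℝ (Fin d)), ¬ AEGateauxDifferentiable μ G) ∧
    -- while it is stochastically differentiable as soon as some version of it is,
    (∀ F : M → EuclideanSpace ℝ (Fin d), (∃ D, HasStochasticDeriv μ Cn F D) →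
      StochasticallyDifferentiable μ Cn (F : Germ (ae μ) (EuclideanSpace ℝ (Fin d)))) ∧
    -- so that stochastic differentiability does not imply a.e. Gâteaux differentiability
    (¬ ∀ G : Germ (ae μ) (EuclideanSpace ℝ (Fin d)),
      StochasticallyDifferentiable μ Cn G → AEGateauxDifferentiable μ G) ∧
    -- the failure occurs along every direction outside the Cameron--Martin space, and such
    -- directions exist
    (∃ h : M, h ∉ cameronMartin μ) ∧
    ∀ h : M, h ∉ cameronMartin μ →
      (∀ t : ℝ, t ≠ 0 → (μ.map fun m => m + t • h) ⟂ₘ μ) ∧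
      ∀ F : M → EuclideanSpace ℝ (Fin d), ∃ F' : M → EuclideanSpace ℝ (Fin d),
        F' =ᵐ[μ] F ∧ (Measurable F → Measurable F') ∧
        (∀ D, HasStochasticDeriv μ Cn F D → HasStochasticDeriv μ Cn F' D) ∧
        (∀ᵐ m ∂μ, ¬ LineDifferentiableAt ℝ F' m h) ∧
        ¬ ∃ D, HasAEGateauxDeriv μ F' D := by
  have : SecondCountableTopology M := UniformSpace.secondCountable_of_separable M
  have h2 : MemLp id 2 μ := IsGaussian.memLp_two_id
  -- Makes `ℝ^d` nontrivial, so that there are two values to oscillate between.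
  have : Nonempty (Fin d) := ⟨⟨0, hd⟩⟩
  -- Stated with the weaker sequential derivative, so that its failure settles both functions and
  -- classes.
  have key : ∀ h : M, h ∉ cameronMartin μ →
      (∀ t : ℝ, t ≠ 0 → (μ.map fun m => m + t • h) ⟂ₘ μ) ∧
      ∀ F : M → EuclideanSpace ℝ (Fin d), ∃ F' : M → EuclideanSpace ℝ (Fin d),
        F' =ᵐ[μ] F ∧ (Measurable F → Measurable F') ∧
        (∀ D, HasStochasticDeriv μ Cn F D → HasStochasticDeriv μ Cn F' D) ∧
        (∀ᵐ m ∂μ, ¬ LineDifferentiableAt ℝ F' m h) ∧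
        ¬ ∃ D, HasAEGateauxDerivSeq μ F' D := by
    intro h hh
    obtain ⟨A, hA, hAμ, hCA, hhA⟩ := exists_subspace_of_notMem_cameronMartin h2 hh
    refine ⟨fun t ht => mutuallySingular_map_add_of_subspace hA hAμ
      fun hth => hhA ((A.smul_mem_iff ht).1 hth), fun F => ?_⟩
    obtain ⟨F', hF', hmeas, hosc⟩ := exists_oscillating_extension hA hhA F
    refine ⟨F', hAμ.mono hF', hmeas, fun D hD => hD.of_eqOn_subspace hAμ hCA hF', ?_,
      not_hasAEGateauxDerivSeq (hAμ.mono hosc)⟩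
    filter_upwards [hAμ] with m hm hdiff
    exact hosc m hm _ (LineDifferentiableAt.tendsto_inv_add_one hdiff)
  have hnot : ∀ G : Germ (ae μ) (EuclideanSpace ℝ (Fin d)), ¬ AEGateauxDifferentiable μ G := by
    intro G hG
    induction G using Germ.inductionOn with | h F => ?_
    obtain ⟨h, hh⟩ := exists_notMem_cameronMartin hM h2
    obtain ⟨F', hF', -, -, -, hno⟩ := (key h hh).2 F
    exact hno (hG F' (Germ.coe_eq.2 hF'))
  have hsto : ∀ F : M → EuclideanSpace ℝ (Fin d), (∃ D, HasStochasticDeriv μ Cn F D) →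
      StochasticallyDifferentiable μ Cn (F : Germ (ae μ) (EuclideanSpace ℝ (Fin d))) := by
    rintro F ⟨D, hD⟩ F' hF'
    exact ⟨D, hD.seq_of_ae_eq hμ (Germ.coe_eq.1 hF')⟩
  -- The class of the zero function refutes the implication.
  refine ⟨hnot, hsto, fun hall => hnot _ (hall _ (hsto 0 ⟨0, hasStochasticDeriv_zero μ Cn⟩)),
    exists_notMem_cameronMartin hM h2, fun h hh => ⟨(key h hh).1, fun F => ?_⟩⟩
  obtain ⟨F', h1, h3, h4, h5, h6⟩ := (key h hh).2 F
  exact ⟨F', h1, h3, h4, h5, fun ⟨D, hD⟩ => h6 ⟨D, hD.seq⟩⟩
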